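/- For integers $p\ge 2$ and $m\ge 0$, let $\mathrm{BX}(p,m)$ (the Bahri--Xu conjecture for $p$ points in $\mathbb R^m$) be the following assertion: there is a constant $c=c(p,m)>0$, depending only on $p$ and $m$, such that for all pairwise distinct $x_1,\dots,x_p\in\mathbb R^m$ and all $U=(u_1,\dots,u_p)^T\in\mathbb R^p$, $$|AU|^2+\sup_{1\le k\le p}\left|U^T\frac{\partial A}{\partial x_k}U\right|\;\ge\; c\sum_{i=1}^{p}\sum_{j\ne i}\frac{u_j^2}{|x_i-x_j|^2},$$ where $A=(a_{ij})$ is the $p\times p$ matrix with $a_{ii}=0$ and $a_{ij}=1/|x_i-x_j|$ for $i\neq j$, where $\partial A/\partial x_k$ is the vector-valued matrix whose $(i,j)$ entry is the gradient of $a_{ij}$ with respect to $x_k\in\mathbb R^m$, and where $|\cdot|$ is the Euclidean norm. Theorem. Let $m\ge 0$ and $p_0\ge 4$ be integers. Then $\mathrm{BX}(p,m)$ holds for every $p$ with $4\le p\le p_0$ if and only if, for every $p$ with $4\le p\le p_0$ and all pairwise distinct points $y_1,\dots,y_p$ of the unit sphere $\mathbb S^m\subset\mathbb R^{m+1}$,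 the linear system $$\sum_{j\ne i}\frac{y_i-y_j}{|y_i-y_j|^3}\,v_j=0,\qquad 1\le i\le p,$$ in the unknowns $v_1,\dots,v_p\in\mathbb R$ has only the zero solution. -/

import Mathlib

noncomputable section

namespace BahriXu

/-- The matrix `A` of the points `x₁, …, x_p` of `ℝᵐ`: zero on the diagonal and
`1 / |x_i - x_j|` off the diagonal. -/
def interactionMatrix {p m : ℕ} (x : Fin p → EuclideanSpace ℝ (Fin m)) :
    Matrix (Fin p) (Fin p) ℝ :=
  Matrix.of fun i j => if i = j then 0 else 1 / ‖x i - x j‖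

/-- The vector-valued matrix `∂A/∂x_k`: each entry is the gradient, with respect to the `k`-th
point alone, of the corresponding entry of `A`. (For distinct points every entry of `A` is
differentiable in each point.) -/
def partialMatrix {p m : ℕ} (x : Fin p → EuclideanSpace ℝ (Fin m)) (k : Fin p) :
    Matrix (Fin p) (Fin p) (EuclideanSpace ℝ (Fin m)) :=
  Matrix.of fun i j => gradient (fun z => interactionMatrix (Function.update x k z) i j) (x k)

/-- `Uᵀ B U` for a vector-valued square matrix `B`. -/
def quadForm {p m : ℕ} (B : Matrix (Fin p) (Fin p) (EuclideanSpace ℝ (Fin m)))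
    (U : Fin p → ℝ) : EuclideanSpace ℝ (Fin m) :=
  ∑ i, ∑ j, (U i * U j) • B i j

/-- The Bahri-Xu conjecture for `p` points in `ℝᵐ`: there is `c > 0`, depending only on `p` and
`m`, such that for all distinct `x₁, …, x_p` in `ℝᵐ` and all `U` in `ℝᵖ`
`|AU|² + sup_k |Uᵀ (∂A/∂x_k) U| ≥ c * ∑_{i ≠ j} u_j² / |x_i - x_j|²`. -/
def Conjecture (p m : ℕ) : Prop :=
  ∃ c : ℝ, 0 < c ∧
    ∀ x : Fin p → EuclideanSpace ℝ (Fin m), Function.Injective x →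
      ∀ U : Fin p → ℝ,
        c * ∑ i, ∑ j ∈ Finset.univ.erase i, U j ^ 2 / ‖x i - x j‖ ^ 2 ≤
          ‖WithLp.toLp 2 ((interactionMatrix x).mulVec U)‖ ^ 2 +
            ⨆ k : Fin p, ‖quadForm (partialMatrix x k) U‖

end BahriXu

end

/-!
For charges `v_j` at points `z_j`, consider the Coulomb potential `∑_j v_j / |z_i - z_j|` and the
field `∑_j v_j (z_i - z_j) / |z_i - z_j|³` at the point `z_i`. The left-hand side of the Bahri-Xu
inequality measures the potentials and the forces `v_i • field` at the points
(`coulombPotential_eq_mulVec`, `quadForm_partialMatrix`), and the system on the sphere says that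
the field vanishes at every point. On the unit sphere the radial component of the field is half the
potential, so that the potential vanishes as well. The vanishing of both is preserved by inversions
(`coulombPotential_inversion`, `coulombField_inversion`), so stereographic projection matches
equilibria on `𝕊ᵐ` with equilibria in `ℝᵐ`.

An equilibrium on the sphere, projected from a point of the sphere which it does not use, makes the
left-hand side of the inequality vanish, which contradicts the conjecture
(`Conjecture.eq_zero_of_sphere`).

Conversely, if the inequality fails, take configurations with `∑ u_j² / |x_i - x_j|² = 1` whose
potentials and forces tend to zero, and pass to limits along an ultrafilter. Among the pairs for
which the limit `T k j` of `u_j / |x_k - x_j|` is non-zero, let `(l, i)` be one of smallest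
distance, and rescale so that `x_i = 0` and `|x_l - x_i| = 1`
(`exists_rescaled_of_not_conjecture`). Points now converge or escape to infinity. Pairs at
infinitesimal distance have `T k j = 0`, so points with the same limit neither carry charge nor
influence each other, and the points escaping to infinity contribute the same constant `c` to all
potentials and nothing to the fields (`exists_limit_of_not_conjecture`). The limit is therefore an
equilibrium in a constant potential `c`. Under stereographic projection the constant becomes a
charge `c` at the pole, itself in equilibrium because the forces sum to zero
(`coulombField_option_inversion`). If `c ≠ 0`, some point has escaped, so the sphere carries at
most `p` points in all. If `c = 0`, at least two charges remain, since the potential at the limit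
of `x_l` vanishes. In both cases the system on the sphere has a non-zero solution with at least two
and at most `p` points. Two or three points are excluded directly, as two chords from a point of
the sphere are linearly independent.
-/

namespace BahriXu

open Filter Topology EuclideanGeometry

/-! ### Coulomb potential and field of finitely many charges, and inversions -/

section Configurations

variable {ι E F : Type*} [Fintype ι] [NormedAddCommGroup E] [InnerProductSpace ℝ E]
  [NormedAddCommGroup F] [InnerProductSpace ℝ F]

/-- The potential created at `z i` by charges `v j` placed at the other points `z j`. The term
`j = i` is `v i / 0 = 0`. -/
noncomputable def coulombPotential (z : ι → E) (v : ι → ℝ) (i : ι) : ℝ :=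
  ∑ j, v j / ‖z i - z j‖

/-- The field created at `z i` by charges `v j` placed at the other points `z j`. -/
noncomputable def coulombField (z : ι → E) (v : ι → ℝ) (i : ι) : E :=
  ∑ j, (v j / ‖z i - z j‖ ^ 3) • (z i - z j)

theorem coulombField_eq_sum_erase [DecidableEq ι] (z : ι → E) (v : ι → ℝ) (i : ι) :
    coulombField z v i = ∑ j ∈ Finset.univ.erase i, (v j / ‖z i - z j‖ ^ 3) • (z i - z j) := by
  rw [coulombField, Finset.sum_erase _ (by simp)]

/-- Action equals reaction: the forces `v i • coulombField z v i` sum to zero. -/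
theorem sum_smul_coulombField (z : ι → E) (v : ι → ℝ) :
    ∑ i, v i • coulombField z v i = 0 := by
  suffices h : ∑ i, v i • coulombField z v i = -∑ i, v i • coulombField z v i by
    have h2 : (2 : ℝ) • ∑ i, v i • coulombField z v i = 0 := by
      rw [two_smul, ← eq_neg_iff_add_eq_zero]
      exact h
    exact (smul_eq_zero.1 h2).resolve_left two_ne_zero
  simp only [coulombField, Finset.smul_sum]
  rw [← Finset.sum_neg_distrib]
  conv_rhs => enter [2, i]; rw [← Finset.sum_neg_distrib]
  rw [Finset.sum_comm]
  refine Finset.sum_congr rfl fun i _ => Finset.sum_congr rfl fun j _ => ?_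
  rw [norm_sub_rev, ← neg_sub (z i) (z j), smul_smul, smul_smul, smul_neg]
  congr 2
  ring

theorem coulombPotential_comp (Φ : E →ₗᵢ[ℝ] F) (z : ι → E) (v : ι → ℝ) (i : ι) :
    coulombPotential (fun j => Φ (z j)) v i = coulombPotential z v i := by
  simp only [coulombPotential, ← map_sub, LinearIsometry.norm_map]

theorem coulombField_comp (Φ : E →ₗᵢ[ℝ] F) (z : ι → E) (v : ι → ℝ) (i : ι) :
    coulombField (fun j => Φ (z j)) v i = Φ (coulombField z v i) := by
  simp only [coulombField, ← map_sub, LinearIsometry.norm_map, map_sum, map_smul]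

/-- On the unit sphere the radial component of the field is half the potential. -/
theorem two_mul_inner_coulombField (z : ι → E) (hz : ∀ i, ‖z i‖ = 1) (v : ι → ℝ) (i : ι) :
    2 * inner ℝ (z i) (coulombField z v i) = coulombPotential z v i := by
  simp only [coulombField, coulombPotential, inner_sum, Finset.mul_sum, real_inner_smul_right]
  refine Finset.sum_congr rfl fun j _ => ?_
  rcases eq_or_ne (z i) (z j) with h | h
  · simp [h]
  have hd : ‖z i - z j‖ ≠ 0 := norm_ne_zero_iff.2 (sub_ne_zero.2 h)
  have key : 2 * inner ℝ (z i) (z i - z j) = ‖z i - z j‖ ^ 2 := by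
    rw [norm_sub_sq_real, inner_sub_right, real_inner_self_eq_norm_sq, hz, hz]
    ring
  rw [mul_left_comm, key]
  field_simp

theorem norm_inversion_sub_inversion {q a b : E} (R : ℝ) (ha : a ≠ q) (hb : b ≠ q) :
    ‖inversion q R a - inversion q R b‖ = R ^ 2 / (‖a - q‖ * ‖b - q‖) * ‖a - b‖ := by
  simpa only [dist_eq_norm] using dist_inversion_inversion ha hb R

theorem inversion_sub_center (q a : E) (R : ℝ) :
    inversion q R a - q = (R ^ 2 / ‖a - q‖ ^ 2) • (a - q) := by
  simp [inversion, dist_eq_norm, div_pow]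

/-- The inversion changes the potential by a conformal factor. -/
theorem coulombPotential_inversion {R : ℝ} (hR : R ≠ 0) (q : E) (z : ι → E)
    (hz : ∀ i, z i ≠ q) (v : ι → ℝ) (i : ι) :
    coulombPotential (fun j => inversion q R (z j)) (fun j => v j / ‖z j - q‖) i =
      ‖z i - q‖ / R ^ 2 * coulombPotential z v i := by
  simp only [coulombPotential, Finset.mul_sum]
  refine Finset.sum_congr rfl fun j _ => ?_
  have hi : ‖z i - q‖ ≠ 0 := norm_ne_zero_iff.2 (sub_ne_zero.2 (hz i))
  have hj : ‖z j - q‖ ≠ 0 := norm_ne_zero_iff.2 (sub_ne_zero.2 (hz j))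
  rw [norm_inversion_sub_inversion R (hz i) (hz j)]
  rcases eq_or_ne (z i) (z j) with h | h
  · simp [h]
  have hd : ‖z i - z j‖ ≠ 0 := norm_ne_zero_iff.2 (sub_ne_zero.2 h)
  field_simp

/-- Under the inversion the field at a point becomes a combination of the field and of the
potential at the inverse point. -/
theorem coulombField_inversion {R : ℝ} (hR : R ≠ 0) (q : E) (z : ι → E)
    (hz : ∀ i, z i ≠ q) (v : ι → ℝ) (i : ι) :
    coulombField (fun j => inversion q R (z j)) (fun j => v j / ‖z j - q‖) i =
      (‖z i - q‖ / R ^ 4) • (‖z i - q‖ ^ 2 • coulombField z v i +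
        (coulombPotential z v i - 2 * inner ℝ (z i - q) (coulombField z v i)) • (z i - q)) := by
  simp only [coulombField, coulombPotential, inner_sum, Finset.mul_sum, Finset.smul_sum,
    ← Finset.sum_sub_distrib, Finset.sum_smul, ← Finset.sum_add_distrib, real_inner_smul_right]
  refine Finset.sum_congr rfl fun j _ => ?_
  have hi : ‖z i - q‖ ≠ 0 := norm_ne_zero_iff.2 (sub_ne_zero.2 (hz i))
  have hj : ‖z j - q‖ ≠ 0 := norm_ne_zero_iff.2 (sub_ne_zero.2 (hz j))
  rw [norm_inversion_sub_inversion R (hz i) (hz j)]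
  rcases eq_or_ne (z i) (z j) with h | h
  · simp [h]
  have hd : ‖z i - z j‖ ≠ 0 := norm_ne_zero_iff.2 (sub_ne_zero.2 h)
  have hin : 2 * inner ℝ (z i - q) (z i - z j) =
      ‖z i - z j‖ ^ 2 + ‖z i - q‖ ^ 2 - ‖z j - q‖ ^ 2 := by
    have h1 : z j - q = (z i - q) - (z i - z j) := by abel
    rw [h1, norm_sub_sq_real (z i - q)]
    ring
  have hsub : inversion q R (z i) - inversion q R (z j) =
      (R ^ 2 / ‖z i - q‖ ^ 2) • (z i - q) -
        (R ^ 2 / ‖z j - q‖ ^ 2) • ((z i - q) - (z i - z j)) := by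
    rw [← sub_sub_sub_cancel_right _ _ q, inversion_sub_center, inversion_sub_center,
      sub_sub_sub_cancel_left]
  rw [hsub, mul_left_comm 2, hin]
  generalize z i - q = a at *
  generalize z i - z j = b at *
  match_scalars
  · field_simp
    ring
  · field_simp

end Configurations

/-! ### The gradient of the interaction matrix -/

section Gradient

variable {E : Type*} [NormedAddCommGroup E] [InnerProductSpace ℝ E] [CompleteSpace E]

theorem hasGradientAt_one_div_norm_sub {a b : E} (h : a ≠ b) :
    HasGradientAt (fun z => 1 / ‖z - b‖) (-((1 / ‖a - b‖ ^ 3) • (a - b))) a := by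
  have hd : 0 < ‖a - b‖ := norm_pos_iff.2 (sub_ne_zero.2 h)
  rw [hasGradientAt_iff_hasFDerivAt]
  have h1 : HasFDerivAt (fun z : E => z - b) (ContinuousLinearMap.id ℝ E) a :=
    (hasFDerivAt_id a).sub_const b
  have h2 := h1.norm_sq
  have h3 := h2.sqrt (by positivity)
  simp only [Real.sqrt_sq (norm_nonneg _)] at h3
  simp only [one_div]
  refine ((hasDerivAt_inv hd.ne').comp_hasFDerivAt a h3).congr_fderiv ?_
  ext w
  simp
  field_simp

end Gradient

section Euclidean

variable {p m : ℕ}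

theorem coulombPotential_eq_mulVec (x : Fin p → EuclideanSpace ℝ (Fin m)) (U : Fin p → ℝ)
    (k : Fin p) : (interactionMatrix x).mulVec U k = coulombPotential x U k := by
  simp only [Matrix.mulVec, dotProduct, interactionMatrix, Matrix.of_apply, coulombPotential]
  refine Finset.sum_congr rfl fun j _ => ?_
  split_ifs with h
  · simp [h]
  · ring

theorem partialMatrix_apply_left {x : Fin p → EuclideanSpace ℝ (Fin m)}
    (hx : Function.Injective x) (k j : Fin p) :
    partialMatrix x k k j = -((1 / ‖x k - x j‖ ^ 3) • (x k - x j)) := by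
  simp only [partialMatrix, interactionMatrix, Matrix.of_apply]
  rcases eq_or_ne k j with rfl | h
  · simp [gradient_fun_const]
  · simp only [if_neg h, Function.update_self, Function.update_of_ne h.symm]
    exact (hasGradientAt_one_div_norm_sub (hx.ne h)).gradient

theorem partialMatrix_apply_right {x : Fin p → EuclideanSpace ℝ (Fin m)} (k i : Fin p) :
    partialMatrix x k i k = partialMatrix x k k i := by
  simp only [partialMatrix, interactionMatrix, Matrix.of_apply]
  congr 1
  ext z
  rw [norm_sub_rev]
  simp only [eq_comm]

theorem partialMatrix_apply_of_ne {x : Fin p → EuclideanSpace ℝ (Fin m)} {k i j : Fin p}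
    (hi : i ≠ k) (hj : j ≠ k) : partialMatrix x k i j = 0 := by
  simp only [partialMatrix, interactionMatrix, Matrix.of_apply, Function.update_of_ne hi,
    Function.update_of_ne hj, gradient_fun_const]

/-- Only the `k`-th row and the `k`-th column of `∂A/∂x_k` are non-zero, and each of them
contributes the force on the `k`-th point. -/
theorem quadForm_partialMatrix {x : Fin p → EuclideanSpace ℝ (Fin m)}
    (hx : Function.Injective x) (U : Fin p → ℝ) (k : Fin p) :
    quadForm (partialMatrix x k) U = (-2 : ℝ) • U k • coulombField x U k := by
  have hrow : ∑ j, (U k * U j) • partialMatrix x k k j = -(U k • coulombField x U k) := by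
    rw [coulombField, Finset.smul_sum, ← Finset.sum_neg_distrib]
    refine Finset.sum_congr rfl fun j _ => ?_
    rw [partialMatrix_apply_left hx, smul_neg, smul_smul, smul_smul]
    congr 2
    ring
  have hother : ∀ i ≠ k, ∑ j, (U i * U j) • partialMatrix x k i j =
      (U k * U i) • partialMatrix x k k i := by
    intro i hi
    rw [Finset.sum_eq_single k, partialMatrix_apply_right, mul_comm]
    · intro j _ hj
      rw [partialMatrix_apply_of_ne hi hj, smul_zero]
    · simp
  have hkk : partialMatrix x k k k = 0 := by simp [partialMatrix_apply_left hx]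
  rw [quadForm, ← Finset.add_sum_erase _ _ (Finset.mem_univ k), hrow,
    Finset.sum_congr rfl fun i hi => hother i (Finset.ne_of_mem_erase hi),
    Finset.sum_erase _ (by simp [hkk]), hrow]
  module

/-- The diagonal terms on the right vanish because division by zero gives zero. -/
theorem sum_erase_eq_sum_sq (x : Fin p → EuclideanSpace ℝ (Fin m)) (U : Fin p → ℝ) :
    ∑ i, ∑ j ∈ Finset.univ.erase i, U j ^ 2 / ‖x i - x j‖ ^ 2 =
      ∑ i, ∑ j, (U j / ‖x i - x j‖) ^ 2 := by
  refine Finset.sum_congr rfl fun i _ => ?_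
  rw [Finset.sum_erase _ (by simp)]
  simp only [div_pow]

/-- The conjectured inequality excludes non-zero charges with vanishing potential and field. -/
theorem Conjecture.eq_zero (h : Conjecture p m) (hp : 2 ≤ p)
    {x : Fin p → EuclideanSpace ℝ (Fin m)} (hx : Function.Injective x) {U : Fin p → ℝ}
    (hpot : ∀ i, coulombPotential x U i = 0) (hfield : ∀ i, coulombField x U i = 0) : U = 0 := by
  obtain ⟨c, hc, H⟩ := h
  have h1 := H x hx U
  have h2 : (interactionMatrix x).mulVec U = 0 := by
    ext k
    rw [coulombPotential_eq_mulVec, hpot, Pi.zero_apply]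
  simp only [quadForm_partialMatrix hx, hfield, h2, smul_zero, norm_zero, WithLp.toLp_zero,
    sum_erase_eq_sum_sq, Real.iSup_const_zero] at h1
  have h3 : ∑ i, ∑ j, (U j / ‖x i - x j‖) ^ 2 = 0 := by
    refine le_antisymm ?_ (by positivity)
    by_contra! h4
    have := mul_pos hc h4
    linarith
  ext j
  have : Nontrivial (Fin p) := Fin.nontrivial_iff_two_le.2 hp
  obtain ⟨i, hij⟩ := exists_ne j
  rw [Finset.sum_eq_zero_iff_of_nonneg fun _ _ => by positivity] at h3
  have h4 := h3 i (Finset.mem_univ i)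
  rw [Finset.sum_eq_zero_iff_of_nonneg fun _ _ => by positivity] at h4
  have h5 := h4 j (Finset.mem_univ j)
  rw [sq_eq_zero_iff, div_eq_zero_iff, norm_eq_zero, sub_eq_zero, hx.eq_iff] at h5
  exact h5.resolve_right hij

end Euclidean

/-! ### Limits of configurations violating the inequality -/

section Limits

variable {α E : Type*} [NormedAddCommGroup E] [ProperSpace E]

theorem exists_tendsto_or_norm_tendsto_atTop (L : Ultrafilter α) (f : α → E) :
    ∃ a, Tendsto f L (𝓝 a) ∨ Tendsto (fun n => ‖f n‖) L atTop := by
  by_cases h : Tendsto (fun n => ‖f n‖) L atTop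
  · exact ⟨0, Or.inr h⟩
  simp only [tendsto_atTop, not_forall, ← Ultrafilter.eventually_not, not_le] at h
  obtain ⟨C, hC⟩ := h
  obtain ⟨a, -, ha⟩ := (isCompact_closedBall (0 : E) C).ultrafilter_le_nhds (L.map f)
    (by
      refine tendsto_principal.2 ?_
      filter_upwards [hC] with n hn
      simpa using hn.le)
  exact ⟨a, Or.inl ha⟩

theorem exists_tendsto_of_norm_le (L : Ultrafilter α) (f : α → E) {C : ℝ}
    (h : ∀ n, ‖f n‖ ≤ C) : ∃ a, Tendsto f L (𝓝 a) := by
  obtain ⟨a, ha | ha⟩ := exists_tendsto_or_norm_tendsto_atTop L f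
  · exact ⟨a, ha⟩
  · obtain ⟨n, hn⟩ := (ha.eventually_gt_atTop C).exists
    exact absurd (h n) hn.not_ge

end Limits

section Scaling

variable {ι E : Type*} [Fintype ι] [NormedAddCommGroup E] [InnerProductSpace ℝ E]

theorem div_norm_smul_sub {c : ℝ} (hc : 0 < c) (b x y : E) (u : ℝ) :
    (c * u) / ‖c • (x - b) - c • (y - b)‖ = u / ‖x - y‖ := by
  rw [← smul_sub, sub_sub_sub_cancel_right, norm_smul, Real.norm_of_nonneg hc.le,
    mul_div_mul_left _ _ hc.ne']

/-- The forces are unchanged when positions and charges are multiplied by the same factor. -/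
theorem smul_coulombField_smul_sub {c : ℝ} (hc : 0 < c) (b : E) (x : ι → E) (u : ι → ℝ) (k : ι) :
    (c * u k) • coulombField (fun j => c • (x j - b)) (fun j => c * u j) k =
      u k • coulombField x u k := by
  simp only [coulombField, Finset.smul_sum]
  refine Finset.sum_congr rfl fun j _ => ?_
  rw [← smul_sub, sub_sub_sub_cancel_right, norm_smul, Real.norm_of_nonneg hc.le, smul_smul,
    smul_smul, smul_smul]
  congr 1
  rcases eq_or_ne (x k) (x j) with h | h
  · simp [h]
  have hd : ‖x k - x j‖ ≠ 0 := norm_ne_zero_iff.2 (sub_ne_zero.2 h)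
  field_simp

end Scaling

section Euclidean

variable {p m : ℕ}

/-- If the conjecture fails, there are configurations, normalised so that the right-hand sum
is `1`, whose potentials and forces tend to zero. -/
theorem exists_normalised_of_not_conjecture (h : ¬ Conjecture p m) :
    ∃ (x : ℕ → Fin p → EuclideanSpace ℝ (Fin m)) (U : ℕ → Fin p → ℝ),
      (∀ n, Function.Injective (x n)) ∧
      (∀ n, ∑ i, ∑ j, (U n j / ‖x n i - x n j‖) ^ 2 = 1) ∧
      (∀ k, Tendsto (fun n => coulombPotential (x n) (U n) k) atTop (𝓝 0)) ∧
      (∀ k, Tendsto (fun n => U n k • coulombField (x n) (U n) k) atTop (𝓝 0)) := by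
  have key : ∀ n : ℕ, ∃ (x : Fin p → EuclideanSpace ℝ (Fin m)) (U : Fin p → ℝ),
      Function.Injective x ∧ ∑ i, ∑ j, (U j / ‖x i - x j‖) ^ 2 = 1 ∧
      (∀ k, ‖coulombPotential x U k‖ ^ 2 ≤ 1 / ((n : ℝ) + 1)) ∧
      (∀ k, ‖U k • coulombField x U k‖ ≤ 1 / ((n : ℝ) + 1)) := by
    intro n
    simp only [Conjecture, not_exists, not_and, not_forall, not_le] at h
    obtain ⟨x, hx, U, hU⟩ := h (1 / ((n : ℝ) + 1)) (by positivity)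
    rw [sum_erase_eq_sum_sq] at hU
    simp only [quadForm_partialMatrix hx] at hU
    set R := ∑ i, ∑ j, (U j / ‖x i - x j‖) ^ 2 with hR
    have hsup : 0 ≤ ⨆ k, ‖(-2 : ℝ) • U k • coulombField x U k‖ :=
      Real.iSup_nonneg fun _ => norm_nonneg _
    have hRpos : 0 < R := by
      by_contra! h0
      have : 1 / ((n : ℝ) + 1) * R ≤ 0 := mul_nonpos_of_nonneg_of_nonpos (by positivity) h0
      nlinarith [sq_nonneg ‖WithLp.toLp 2 ((interactionMatrix x).mulVec U)‖]
    have hs : 0 < √R := Real.sqrt_pos.2 hRpos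
    have hss : √R ^ 2 = R := Real.sq_sqrt hRpos.le
    have hpot : ∀ k, coulombPotential x (fun j => U j / √R) k = coulombPotential x U k / √R := by
      intro k
      simp only [coulombPotential, Finset.sum_div]
      exact Finset.sum_congr rfl fun j _ => div_right_comm _ _ _
    have hfield : ∀ k, (U k / √R) • coulombField x (fun j => U j / √R) k =
        R⁻¹ • U k • coulombField x U k := by
      intro k
      simp only [coulombField, Finset.smul_sum, smul_smul]
      refine Finset.sum_congr rfl fun j _ => ?_
      congr 1
      conv_rhs => rw [← hss]
      field_simp
    refine ⟨x, fun j => U j / √R, hx, ?_, fun k => ?_, fun k => ?_⟩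
    · have : ∀ i j, (U j / √R / ‖x i - x j‖) ^ 2 = (U j / ‖x i - x j‖) ^ 2 / R := by
        intro i j
        rw [div_right_comm, div_pow, hss]
      simp only [this, ← Finset.sum_div]
      exact div_self hRpos.ne'
    · rw [hpot, norm_div, div_pow, Real.norm_of_nonneg hs.le, hss, div_le_iff₀ hRpos]
      have h1 : ‖coulombPotential x U k‖ ≤
          ‖WithLp.toLp 2 ((interactionMatrix x).mulVec U)‖ := by
        rw [← coulombPotential_eq_mulVec]
        exact PiLp.norm_apply_le (WithLp.toLp 2 ((interactionMatrix x).mulVec U)) k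
      have h2 := pow_le_pow_left₀ (norm_nonneg _) h1 2
      linarith
    · rw [hfield, norm_smul, norm_inv, Real.norm_of_nonneg hRpos.le, inv_mul_le_iff₀ hRpos]
      have h1 : ‖(-2 : ℝ) • U k • coulombField x U k‖ ≤
          ⨆ k, ‖(-2 : ℝ) • U k • coulombField x U k‖ :=
        le_ciSup (f := fun k => ‖(-2 : ℝ) • U k • coulombField x U k‖)
          (Set.finite_range _).bddAbove k
      rw [norm_smul, norm_neg, Real.norm_ofNat] at h1
      nlinarith [sq_nonneg ‖WithLp.toLp 2 ((interactionMatrix x).mulVec U)‖,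
        norm_nonneg (U k • coulombField x U k)]
  choose x U hx hR hP hF using key
  refine ⟨x, U, hx, hR, fun k => ?_, fun k => ?_⟩
  · have h1 : Tendsto (fun n => ‖coulombPotential (x n) (U n) k‖ ^ 2) atTop (𝓝 0) :=
      squeeze_zero (fun _ => by positivity) (fun n => hP n k) tendsto_one_div_add_atTop_nhds_zero_nat
    rw [tendsto_zero_iff_norm_tendsto_zero]
    simpa [Real.sqrt_sq_eq_abs] using h1.sqrt
  · exact squeeze_zero_norm (fun n => hF n k) tendsto_one_div_add_atTop_nhds_zero_nat

/-- A failure of the conjecture, seen at the smallest scale at which a charge is not negligible: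
the ratios `u_j / |y_k - y_j|` have limits `T k j`, some limit `T l i` is non-zero, and
`|y_k - y_j| ≥ |y_l - y_i| = 1` whenever `T k j ≠ 0`. -/
theorem exists_rescaled_of_not_conjecture (L : Ultrafilter ℕ) (hL : (L : Filter ℕ) ≤ atTop)
    (h : ¬ Conjecture p m) :
    ∃ (y : ℕ → Fin p → EuclideanSpace ℝ (Fin m)) (u : ℕ → Fin p → ℝ) (T : Fin p → Fin p → ℝ)
      (i l : Fin p),
      (∀ n, Function.Injective (y n)) ∧ (∀ n, y n i = 0) ∧ (∀ n, ‖y n l‖ = 1) ∧ T l i ≠ 0 ∧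
      (∀ k j, Tendsto (fun n => u n j / ‖y n k - y n j‖) L (𝓝 (T k j))) ∧
      (∀ k j, T k j ≠ 0 → ∀ᶠ n in L, 1 ≤ ‖y n k - y n j‖) ∧
      (∀ k, ∑ j, T k j = 0) ∧
      (∀ k, Tendsto (fun n => u n k • coulombField (y n) (u n) k) L (𝓝 0)) := by
  obtain ⟨x, U, hx, hR, hP, hF⟩ := exists_normalised_of_not_conjecture h
  have hbound : ∀ k j n, ‖U n j / ‖x n k - x n j‖‖ ≤ 1 := by
    intro k j n
    rw [← sq_le_one_iff₀ (norm_nonneg _), Real.norm_eq_abs, sq_abs, ← hR n]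
    refine le_trans ?_ (Finset.single_le_sum (fun i _ => by positivity) (Finset.mem_univ k))
    exact Finset.single_le_sum (f := fun j => (U n j / ‖x n k - x n j‖) ^ 2)
      (fun i _ => by positivity) (Finset.mem_univ j)
  choose T hT using fun k j => exists_tendsto_of_norm_le L _ (hbound k j)
  have hne : ∃ q : Fin p × Fin p, T q.1 q.2 ≠ 0 := by
    by_contra! h0
    have h1 : Tendsto (fun n => ∑ i, ∑ j, (U n j / ‖x n i - x n j‖) ^ 2) L
        (𝓝 (∑ i, ∑ j, (T i j) ^ 2)) :=
      tendsto_finsetSum _ fun i _ => tendsto_finsetSum _ fun j _ => (hT i j).pow 2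
    simp only [hR, fun i j => h0 (i, j)] at h1
    have := tendsto_nhds_unique h1 tendsto_const_nhds
    simp at this
  have hmin : ∀ᶠ n in (L : Filter ℕ), ∃ q ∈ {q : Fin p × Fin p | T q.1 q.2 ≠ 0},
      ∀ r : Fin p × Fin p, T r.1 r.2 ≠ 0 → ‖x n q.1 - x n q.2‖ ≤ ‖x n r.1 - x n r.2‖ :=
    .of_forall fun n => Set.exists_min_image _ (fun q : Fin p × Fin p => ‖x n q.1 - x n q.2‖)
      (Set.toFinite _) hne
  rw [Ultrafilter.eventually_exists_mem_iff (Set.toFinite _)] at hmin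
  obtain ⟨⟨l, i⟩, hli, hmin⟩ := hmin
  change T l i ≠ 0 at hli
  have hli' : l ≠ i := by
    rintro rfl
    refine hli (tendsto_nhds_unique (hT l l) ?_)
    simp
  have hs : ∀ n, 0 < ‖x n l - x n i‖⁻¹ := fun n =>
    inv_pos.2 (norm_pos_iff.2 (sub_ne_zero.2 ((hx n).ne hli')))
  refine ⟨fun n k => ‖x n l - x n i‖⁻¹ • (x n k - x n i), fun n k => ‖x n l - x n i‖⁻¹ * U n k,
    T, i, l, fun n a b hab => ?_, fun n => ?_, fun n => ?_, hli, fun k j => ?_, fun k j hkj => ?_,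
    fun k => ?_, fun k => ?_⟩
  · exact hx n (sub_left_injective (smul_right_injective _ (hs n).ne' hab))
  · simp
  · rw [norm_smul, Real.norm_of_nonneg (hs n).le]
    exact inv_mul_cancel₀ (inv_pos.1 (hs n)).ne'
  · simp only [div_norm_smul_sub (hs _)]
    exact hT k j
  · filter_upwards [hmin] with n hn
    rw [← smul_sub, sub_sub_sub_cancel_right, norm_smul, Real.norm_of_nonneg (hs n).le,
      le_inv_mul_iff₀ (inv_pos.1 (hs n)), mul_one]
    exact hn (k, j) hkj
  · exact tendsto_nhds_unique (tendsto_finsetSum _ fun j _ => hT k j) ((hP k).mono_left hL)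
  · simp only [smul_coulombField_smul_sub (hs _)]
    exact (hF k).mono_left hL

/-- If the conjecture fails, there is a limiting configuration: finitely many charges `W` at
points `X`, distinct where the charge is non-zero, which together with a constant `c`, the
potential of the points escaping to infinity, produce neither potential nor field at the charged
points. The point `X l` serves to exclude the case of a single charge. -/
theorem exists_limit_of_not_conjecture (h : ¬ Conjecture p m) :
    ∃ (X : Fin p → EuclideanSpace ℝ (Fin m)) (W : Fin p → ℝ) (c : ℝ) (i l : Fin p),
      W i ≠ 0 ∧ X l ≠ X i ∧ coulombPotential X W l + c = 0 ∧
      (∀ k, W k ≠ 0 → coulombPotential X W k + c = 0) ∧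
      (∀ k, W k ≠ 0 → coulombField X W k = 0) ∧
      Set.InjOn X {k | W k ≠ 0} ∧ (c ≠ 0 → ∃ j, W j = 0) := by
  obtain ⟨y, u, T, i, l, hy, hyi, hyl, hli, hT, hmin, hpot, hfor⟩ :=
    exists_rescaled_of_not_conjecture (hyperfilter ℕ) Nat.hyperfilter_le_atTop h
  set L := hyperfilter ℕ
  choose X hX using fun k => exists_tendsto_or_norm_tendsto_atTop L (fun n => y n k)
  let B : Fin p → Prop := fun k => Tendsto (fun n => y n k) L (𝓝 (X k))
  have hBi : Tendsto (fun n => y n i) L (𝓝 0) := by simp [hyi]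
  have hXi : B i ∧ X i = 0 := by
    rcases hX i with h1 | h1
    · exact ⟨h1, tendsto_nhds_unique h1 hBi⟩
    · exact absurd hBi.norm (not_tendsto_nhds_of_tendsto_atTop h1 _)
  have hXl : B l ∧ ‖X l‖ = 1 := by
    have hl : Tendsto (fun n => ‖y n l‖) L (𝓝 1) := by simp [hyl]
    rcases hX l with h1 | h1
    · exact ⟨h1, tendsto_nhds_unique h1.norm hl⟩
    · exact absurd hl (not_tendsto_nhds_of_tendsto_atTop h1 _)
  have hXli : X l ≠ X i := by
    intro h1
    have := hXl.2
    rw [h1, hXi.2, norm_zero] at this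
    exact zero_ne_one this
  have hmul : ∀ k j, B k → B j → k ≠ j →
      Tendsto (fun n => u n j) L (𝓝 (T k j * ‖X k - X j‖)) := by
    intro k j hk hj hkj
    refine ((hT k j).mul (hk.sub hj).norm).congr fun n => ?_
    exact div_mul_cancel₀ _ (norm_ne_zero_iff.2 (sub_ne_zero.2 ((hy n).ne hkj)))
  have hW : ∀ j, ∃ w, (B j → Tendsto (fun n => u n j) L (𝓝 w)) ∧ (¬ B j → w = 0) := by
    intro j
    by_cases hj : B j
    · rcases eq_or_ne j i with rfl | hji
      · exact ⟨_, fun _ => hmul l j hXl.1 hj fun h1 => hXli (h1 ▸ rfl), fun h1 => absurd hj h1⟩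
      · exact ⟨_, fun _ => hmul i j hXi.1 hj hji.symm, fun h1 => absurd hj h1⟩
    · exact ⟨0, fun h1 => absurd h1 hj, fun _ => rfl⟩
  choose W hW hW0 using hW
  -- Points with the same limit carry no charge in the limit.
  have hcoin : ∀ k j, B k → B j → k ≠ j → X k = X j → W j = 0 := by
    intro k j hk hj hkj hX
    refine tendsto_nhds_unique (hW j hj) ?_
    simpa [hX] using hmul k j hk hj hkj
  have hBW : ∀ j, W j ≠ 0 → B j := fun j hj => by_contra fun h1 => hj (hW0 j h1)
  have hTB : ∀ k j, B k → B j → T k j = W j / ‖X k - X j‖ := by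
    intro k j hk hj
    rcases eq_or_ne (X k) (X j) with h1 | h1
    · -- Limits `T k j ≠ 0` only occur at distance at least `1`.
      rw [h1, sub_self, norm_zero, div_zero]
      by_contra h2
      have h3 := ge_of_tendsto (hk.sub hj).norm (hmin k j h2)
      rw [h1, sub_self, norm_zero] at h3
      exact absurd h3 (by norm_num)
    · exact tendsto_nhds_unique (hT k j)
        ((hW j hj).div (hk.sub hj).norm (norm_ne_zero_iff.2 (sub_ne_zero.2 h1)))
  have hinf : ∀ k j, B k → ¬ B j → Tendsto (fun n => ‖y n k - y n j‖) L atTop := by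
    intro k j hk hj
    have h1 := (hX j).resolve_left hj
    refine tendsto_atTop_mono (fun n => ?_) (h1.atTop_add hk.norm.neg)
    rw [norm_sub_rev, ← sub_eq_add_neg]
    exact norm_sub_norm_le _ _
  -- A point escaping to infinity creates the same potential at all convergent points.
  have hTinf : ∀ k j, B k → ¬ B j → T k j = T i j := by
    intro k j hk hj
    have h1 : Tendsto (fun n => ‖u n j / ‖y n k - y n j‖‖ * ‖y n k‖ * ‖y n j‖⁻¹) L (𝓝 0) := by
      have := (((hT k j).norm).mul hk.norm).mul
        (((hX j).resolve_left hj).inv_tendsto_atTop)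
      simpa using this
    have h2 : Tendsto (fun n => u n j / ‖y n k - y n j‖ - u n j / ‖y n i - y n j‖) L (𝓝 0) := by
      refine squeeze_zero_norm (fun n => ?_) h1
      have hji : j ≠ i := fun h3 => hj (h3 ▸ hXi.1)
      have hkj : k ≠ j := fun h3 => hj (h3 ▸ hk)
      have e1 : 0 < ‖y n k - y n j‖ := norm_pos_iff.2 (sub_ne_zero.2 ((hy n).ne hkj))
      have e2 : 0 < ‖y n j‖ := norm_pos_iff.2 (hyi n ▸ (hy n).ne hji)
      rw [hyi, zero_sub, norm_neg]
      have e3 : u n j / ‖y n k - y n j‖ - u n j / ‖y n j‖ =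
          u n j / ‖y n k - y n j‖ * (‖y n j‖ - ‖y n k - y n j‖) * ‖y n j‖⁻¹ := by
        field_simp
      rw [e3, norm_mul, norm_mul, norm_inv, norm_norm]
      gcongr
      rw [Real.norm_eq_abs, norm_sub_rev (y n k)]
      simpa using abs_norm_sub_norm_le (y n j) (y n j - y n k)
    exact sub_eq_zero.1 (tendsto_nhds_unique ((hT k j).sub (hT i j)) h2)
  classical
  let c := ∑ j, if B j then 0 else T i j
  have hpotc : ∀ k, B k → coulombPotential X W k + c = 0 := by
    intro k hk
    rw [← hpot k, coulombPotential, ← Finset.sum_add_distrib]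
    refine Finset.sum_congr rfl fun j _ => ?_
    split_ifs with hj
    · rw [hTB k j hk hj, add_zero]
    · rw [hTinf k j hk hj, hW0 j hj, zero_div, zero_add]
  refine ⟨X, W, c, i, l, ?_, hXli, hpotc l hXl.1, fun k hk => hpotc k (hBW k hk), fun k hk => ?_,
    ?_, fun hc => ?_⟩
  · intro h1
    rw [hTB l i hXl.1 hXi.1, h1, zero_div] at hli
    exact hli rfl
  · have hk' := hBW k hk
    -- The force tends to zero and the charge does not, so the field does.
    have h1 : Tendsto (fun n => coulombField (y n) (u n) k) L (𝓝 0) := by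
      have h2 := ((hW k hk').inv₀ hk).smul (hfor k)
      rw [smul_zero] at h2
      refine h2.congr' ?_
      filter_upwards [(hW k hk').eventually_ne hk] with n hn
      exact inv_smul_smul₀ hn _
    refine tendsto_nhds_unique (tendsto_finsetSum _ fun j _ => ?_) h1
    rcases eq_or_ne k j with rfl | hkj
    · simp
    by_cases hj : B j
    · have hne : X k ≠ X j := fun h2 => hk (hcoin j k hj hk' hkj.symm h2.symm)
      exact ((hW j hj).div ((hk'.sub hj).norm.pow 3)
        (pow_ne_zero 3 (norm_ne_zero_iff.2 (sub_ne_zero.2 hne)))).smul (hk'.sub hj)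
    · rw [hW0 j hj, zero_div, zero_smul, tendsto_zero_iff_norm_tendsto_zero]
      have h2 := (hT k j).norm.mul (hinf k j hk' hj).inv_tendsto_atTop
      rw [mul_zero] at h2
      refine h2.congr fun n => ?_
      have e1 : 0 < ‖y n k - y n j‖ := norm_pos_iff.2 (sub_ne_zero.2 ((hy n).ne hkj))
      simp only [Pi.inv_apply, norm_smul, norm_div, norm_pow, norm_norm]
      field_simp
  · intro a ha b hb hab
    by_contra hne
    exact hb (hcoin a b (hBW a ha) (hBW b hb) hne hab)
  · by_contra! h1
    exact hc (Finset.sum_eq_zero fun j _ => if_pos (hBW j (h1 j)))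

end Euclidean

/-! ### Charges on the sphere and stereographic projection -/

/-- Charges on at least two and at most `p₀` points of the unit sphere of `E` which produce no field
at any of these points are zero. A single point has to be excluded, as it creates no field at
itself. -/
def SphereRigid (E : Type*) [NormedAddCommGroup E] [InnerProductSpace ℝ E] (p₀ : ℕ) : Prop :=
  ∀ p : ℕ, 2 ≤ p → p ≤ p₀ → ∀ y : Fin p → E, Function.Injective y → (∀ i, ‖y i‖ = 1) →
    ∀ v : Fin p → ℝ, (∀ i, coulombField y v i = 0) → v = 0

section Sphere

variable {ι E : Type*} [Fintype ι] [NormedAddCommGroup E] [InnerProductSpace ℝ E] {p₀ : ℕ}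

theorem coulombField_comp_equiv {κ : Type*} [Fintype κ] (e : κ ≃ ι) (z : ι → E) (v : ι → ℝ)
    (k : κ) : coulombField (z ∘ e) (v ∘ e) k = coulombField z v (e k) :=
  e.sum_comp fun j => (v j / ‖z (e k) - z j‖ ^ 3) • (z (e k) - z j)

theorem SphereRigid.eq_zero (H : SphereRigid E p₀) (h2 : 2 ≤ Fintype.card ι)
    (hp : Fintype.card ι ≤ p₀) {y : ι → E} (hy : Function.Injective y) (hy1 : ∀ i, ‖y i‖ = 1)
    {v : ι → ℝ} (hv : ∀ i, coulombField y v i = 0) : v = 0 := by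
  let e := (Fintype.equivFin ι).symm
  have h := H _ h2 hp (y ∘ e) (hy.comp e.injective) (fun _ => hy1 _) (v ∘ e)
    fun k => by rw [coulombField_comp_equiv, hv]
  ext i
  simpa using congrFun h (e.symm i)

/-- Two chords from a point of the sphere are linearly independent. -/
theorem eq_zero_of_smul_sub_add_smul_sub {a b c : E} (ha : ‖a‖ = 1) (hb : ‖b‖ = 1)
    (hc : ‖c‖ = 1) (hab : a ≠ b) (hac : a ≠ c) (hbc : b ≠ c) {s t : ℝ}
    (h : s • (a - b) + t • (a - c) = 0) : s = 0 := by
  have hdb : 0 < ‖a - b‖ := norm_pos_iff.2 (sub_ne_zero.2 hab)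
  have hdc : 0 < ‖a - c‖ := norm_pos_iff.2 (sub_ne_zero.2 hac)
  have chord : ∀ d : E, ‖d‖ = 1 → 2 * inner ℝ a (a - d) = ‖a - d‖ ^ 2 := by
    intro d hd
    rw [norm_sub_sq_real, inner_sub_right, real_inner_self_eq_norm_sq, ha, hd]
    ring
  have h1 : s * ‖a - b‖ ^ 2 + t * ‖a - c‖ ^ 2 = 0 := by
    have := congrArg (fun z => 2 * inner ℝ a z) h
    simp only [inner_add_right, real_inner_smul_right, inner_zero_right] at this
    rw [← chord b hb, ← chord c hc]
    linarith
  have h2 : |s| * ‖a - b‖ = |t| * ‖a - c‖ := by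
    have := congrArg norm (eq_neg_of_add_eq_zero_left h)
    rwa [norm_neg, norm_smul, norm_smul] at this
  have h3 : |s| * ‖a - b‖ ^ 2 = |t| * ‖a - c‖ ^ 2 := by
    have := congrArg abs (eq_neg_of_add_eq_zero_left h1)
    rwa [abs_neg, abs_mul, abs_mul, abs_of_pos (pow_pos hdb 2), abs_of_pos (pow_pos hdc 2)] at this
  by_contra hs
  have h4 : ‖a - b‖ = ‖a - c‖ := by
    have hpos : 0 < |s| * ‖a - b‖ := by positivity
    have : (|s| * ‖a - b‖) * ‖a - b‖ = (|s| * ‖a - b‖) * ‖a - c‖ := by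
      nth_rewrite 2 [h2]
      linarith
    exact mul_left_cancel₀ hpos.ne' this
  have h5 : t = -s := by
    have : (s + t) * ‖a - c‖ ^ 2 = 0 := by rw [← h1, h4]; ring
    have := (mul_eq_zero.1 this).resolve_right (by positivity)
    linarith
  have h6 : s • (c - b) = 0 := by rw [← h, h5]; module
  exact hbc (sub_eq_zero.1 ((smul_eq_zero.1 h6).resolve_left hs)).symm

/-- Two or three points on a sphere never carry non-zero charges without field. -/
theorem sphereRigid_of_four_le (H : ∀ p : ℕ, 4 ≤ p → p ≤ p₀ → ∀ y : Fin p → E,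
      Function.Injective y → (∀ i, ‖y i‖ = 1) → ∀ v : Fin p → ℝ,
        (∀ i, coulombField y v i = 0) → v = 0) : SphereRigid E p₀ := by
  intro p h2 hp y hy hy1 v hv
  have coef : ∀ i j, i ≠ j → v j / ‖y i - y j‖ ^ 3 = 0 → v j = 0 := fun i j hij h =>
    (div_eq_zero_iff.1 h).resolve_right
      (pow_ne_zero 3 (norm_ne_zero_iff.2 (sub_ne_zero.2 (hy.ne hij))))
  rcases le_or_gt 4 p with h4 | h4
  · exact H p h4 hp y hy hy1 v hv
  interval_cases p
  · have h0 := hv 0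
    have h1 := hv 1
    simp only [coulombField, Fin.sum_univ_two, sub_self, smul_zero, zero_add, add_zero,
      smul_eq_zero, sub_eq_zero, hy.eq_iff, zero_ne_one, one_ne_zero, or_false] at h0 h1
    ext i
    fin_cases i
    · exact coef 1 0 (by decide) h1
    · exact coef 0 1 (by decide) h0
  · have tri : ∀ i j k : Fin 3, i ≠ j → i ≠ k → j ≠ k →
        (v j / ‖y i - y j‖ ^ 3) • (y i - y j) + (v k / ‖y i - y k‖ ^ 3) • (y i - y k) = 0 →
        v j = 0 := fun i j k hij hik hjk h =>
      coef i j hij (eq_zero_of_smul_sub_add_smul_sub (hy1 i) (hy1 j) (hy1 k) (hy.ne hij)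
        (hy.ne hik) (hy.ne hjk) h)
    have h0 := hv 0
    have h1 := hv 1
    simp only [coulombField, Fin.sum_univ_three, sub_self, smul_zero, zero_add, add_zero] at h0 h1
    ext i
    fin_cases i
    · exact tri 1 0 2 (by decide) (by decide) (by decide) h1
    · exact tri 0 1 2 (by decide) (by decide) (by decide) h0
    · exact tri 0 2 1 (by decide) (by decide) (by decide) (by rw [add_comm]; exact h0)

/-- The inversion of centre `q`, `‖q‖ = 1`, and radius `√2` exchanges the unit sphere and the
hyperplane orthogonal to `q`. -/
theorem norm_inversion_of_inner_eq_zero {q a : E} (hq : ‖q‖ = 1) (ha : inner ℝ q a = 0) :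
    ‖inversion q √2 a‖ = 1 := by
  have hqa : ‖a - q‖ ≠ 0 := by
    rw [norm_ne_zero_iff, sub_ne_zero]
    rintro rfl
    rw [real_inner_self_eq_norm_sq, hq] at ha
    norm_num at ha
  have h1 : inversion q √2 a = q + (2 / ‖a - q‖ ^ 2) • (a - q) := by
    rw [← sub_eq_iff_eq_add', inversion_sub_center, Real.sq_sqrt zero_le_two]
  have h2 : inner ℝ q (a - q) = -1 := by
    rw [inner_sub_right, ha, real_inner_self_eq_norm_sq, hq]
    norm_num
  rw [← sq_eq_sq₀ (norm_nonneg _) zero_le_one, h1, norm_add_sq_real, real_inner_smul_right, h2,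
    norm_smul, mul_pow, Real.norm_eq_abs, sq_abs, hq]
  field_simp
  ring

theorem inner_inversion_eq_zero {q a : E} (hq : ‖q‖ = 1) (ha : ‖a‖ = 1) (haq : a ≠ q) :
    inner ℝ q (inversion q √2 a) = 0 := by
  have hqa : ‖a - q‖ ≠ 0 := norm_ne_zero_iff.2 (sub_ne_zero.2 haq)
  have h1 : 2 * inner ℝ q (a - q) = -‖a - q‖ ^ 2 := by
    rw [norm_sub_sq_real, inner_sub_right, real_inner_self_eq_norm_sq, ha, hq, real_inner_comm]
    ring
  rw [← sub_add_cancel (inversion q √2 a) q, inversion_sub_center, Real.sq_sqrt zero_le_two,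
    inner_add_right, real_inner_smul_right, real_inner_self_eq_norm_sq, hq, div_mul_eq_mul_div, h1,
    neg_div, div_self (pow_ne_zero 2 hqa)]
  norm_num

/-- A constant potential `c` in a hyperplane becomes, after inversion, a charge `c` at the centre
`q`. By action and reaction this charge is itself in equilibrium if it is non-zero. -/
theorem coulombField_option_inversion {q : E} {z : ι → E} (hz : ∀ i, z i ≠ q) {v : ι → ℝ} {c : ℝ}
    (hpot : ∀ i, coulombPotential z v i + c = 0) (hfield : ∀ i, coulombField z v i = 0)
    (hc : c ≠ 0) (o : Option ι) :
    coulombField (fun o => o.elim q fun j => inversion q √2 (z j))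
      (fun o => o.elim c fun j => v j / ‖z j - q‖) o = 0 := by
  have hsome : ∀ i, coulombField (fun o : Option ι => o.elim q fun j => inversion q √2 (z j))
      (fun o => o.elim c fun j => v j / ‖z j - q‖) (some i) = 0 := by
    intro i
    have hi : ‖z i - q‖ ≠ 0 := norm_ne_zero_iff.2 (sub_ne_zero.2 (hz i))
    have h1 := coulombField_inversion (Real.sqrt_ne_zero'.2 zero_lt_two) q z hz v i
    rw [hfield, eq_neg_of_add_eq_zero_left (hpot i)] at h1
    rw [coulombField] at h1 ⊢
    rw [Fintype.sum_option]
    simp only [Option.elim_none, Option.elim_some]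
    rw [h1, inversion_sub_center, norm_smul, Real.norm_of_nonneg (by positivity)]
    have h4 : √2 ^ 4 = (4 : ℝ) := by
      rw [show (4 : ℕ) = 2 * 2 from rfl, pow_mul, Real.sq_sqrt zero_le_two]
      norm_num
    rw [Real.sq_sqrt zero_le_two, h4, smul_zero, inner_zero_right]
    generalize z i - q = a at *
    match_scalars
    field_simp
    ring
  have h2 := sum_smul_coulombField (fun o : Option ι => o.elim q fun j => inversion q √2 (z j))
    (fun o => o.elim c fun j => v j / ‖z j - q‖)
  rw [Fintype.sum_option] at h2
  simp only [hsome, smul_zero, Finset.sum_const_zero, add_zero, Option.elim_none] at h2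
  cases o with
  | none => exact (smul_eq_zero.1 h2).resolve_left hc
  | some i => exact hsome i

end Sphere

section Hyperplane

theorem exists_linearIsometry_range_eq_orthogonal (m : ℕ) {q : EuclideanSpace ℝ (Fin (m + 1))}
    (hq : ‖q‖ = 1) :
    ∃ Φ : EuclideanSpace ℝ (Fin m) →ₗᵢ[ℝ] EuclideanSpace ℝ (Fin (m + 1)),
      ∀ z, inner ℝ q z = 0 ↔ ∃ x, Φ x = z := by
  have : Fact (Module.finrank ℝ (EuclideanSpace ℝ (Fin (m + 1))) = m + 1) :=
    ⟨finrank_euclideanSpace_fin⟩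
  have hq0 : q ≠ 0 := by
    rintro rfl
    simp at hq
  let b := OrthonormalBasis.fromOrthogonalSpanSingleton (𝕜 := ℝ) m hq0
  refine ⟨(Submodule.subtypeₗᵢ _).comp b.repr.symm.toLinearIsometry, fun z => ?_⟩
  rw [← Submodule.mem_orthogonal_singleton_iff_inner_right]
  constructor
  · intro hz
    exact ⟨b.repr ⟨z, hz⟩, by simp⟩
  · rintro ⟨x, rfl⟩
    exact (b.repr.symm x).2

/-- On the sphere `𝕊ᵐ` there is room for a further point. -/
theorem exists_norm_eq_one_forall_ne {m p : ℕ} (hp : 3 ≤ p)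
    {y : Fin p → EuclideanSpace ℝ (Fin (m + 1))} (hy : Function.Injective y)
    (hy1 : ∀ i, ‖y i‖ = 1) : ∃ q : EuclideanSpace ℝ (Fin (m + 1)), ‖q‖ = 1 ∧ ∀ i, y i ≠ q := by
  have hinf : (Metric.sphere (0 : EuclideanSpace ℝ (Fin (m + 1))) 1).Infinite := by
    rcases Nat.eq_zero_or_pos m with rfl | hm
    · -- The sphere `𝕊⁰` has only two points.
      exfalso
      have hcoord : ∀ i, y i 0 = 1 ∨ y i 0 = -1 := by
        intro i
        have h1 := EuclideanSpace.norm_sq_eq (y i)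
        rw [hy1, one_pow, Fin.sum_univ_one, Real.norm_eq_abs, sq_abs] at h1
        exact sq_eq_one_iff.1 h1.symm
      have hdet : ∀ i j, y i 0 = y j 0 → i = j := fun i j hij => hy (by
        ext k
        rwa [Fin.eq_zero k])
      have h01 := hdet ⟨0, by omega⟩ ⟨1, by omega⟩
      have h02 := hdet ⟨0, by omega⟩ ⟨2, by omega⟩
      have h12 := hdet ⟨1, by omega⟩ ⟨2, by omega⟩
      simp only [Fin.mk.injEq] at h01 h02 h12
      grind
    · refine (isPreconnected_sphere ?_ 0 1).infinite_of_nontrivial ?_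
      · rw [← Module.finrank_eq_rank, finrank_euclideanSpace_fin]
        exact_mod_cast Nat.lt_add_of_pos_left hm
      · exact ⟨y ⟨0, by omega⟩, by simp [hy1], y ⟨1, by omega⟩, by simp [hy1],
          hy.ne (by simp)⟩
  obtain ⟨q, hq, hqy⟩ := hinf.exists_notMem_finite (Set.finite_range y)
  exact ⟨q, by simpa using hq, fun i h => hqy ⟨i, h⟩⟩

variable {p m p₀ : ℕ}

/-- A solution of the system on the sphere is projected to `ℝᵐ` from a point of the sphere which it
does not use. -/
theorem Conjecture.eq_zero_of_sphere (h : Conjecture p m) (hp : 3 ≤ p)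
    {y : Fin p → EuclideanSpace ℝ (Fin (m + 1))} (hy : Function.Injective y)
    (hy1 : ∀ i, ‖y i‖ = 1) {v : Fin p → ℝ} (hv : ∀ i, coulombField y v i = 0) : v = 0 := by
  obtain ⟨q, hq, hqy⟩ := exists_norm_eq_one_forall_ne hp hy hy1
  obtain ⟨Φ, hΦ⟩ := exists_linearIsometry_range_eq_orthogonal m hq
  choose x hx using fun i => (hΦ _).1 (inner_inversion_eq_zero hq (hy1 i) (hqy i))
  have hR : √(2 : ℝ) ≠ 0 := Real.sqrt_ne_zero'.2 zero_lt_two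
  have hpot : ∀ i, coulombPotential y v i = 0 := fun i => by
    rw [← two_mul_inner_coulombField y hy1, hv, inner_zero_right, mul_zero]
  have hxi : Function.Injective x := fun i j hij =>
    hy (inversion_injective q hR (by rw [← hx, ← hx, hij]))
  have h0 : (fun j => v j / ‖y j - q‖) = 0 := by
    refine h.eq_zero (by omega) hxi (fun i => ?_) fun i => ?_
    · rw [← coulombPotential_comp Φ]
      simp only [hx]
      rw [coulombPotential_inversion hR q y hqy, hpot, mul_zero]
    · refine Φ.injective ?_
      rw [← coulombField_comp Φ, map_zero]
      simp only [hx]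
      rw [coulombField_inversion hR q y hqy, hpot, hv]
      simp
  ext i
  exact (div_eq_zero_iff.1 (congrFun h0 i)).resolve_right
    (norm_ne_zero_iff.2 (sub_ne_zero.2 (hqy i)))

/-- The limit of configurations violating the inequality is projected to the sphere, with a charge
at the pole if the constant part `c` of its potential is non-zero. -/
theorem SphereRigid.conjecture (H : SphereRigid (EuclideanSpace ℝ (Fin (m + 1))) p₀)
    (hp : p ≤ p₀) : Conjecture p m := by
  by_contra hcon
  obtain ⟨X, W, c, i, l, hWi, hli, hpotl, hpot, hfield, hinj, hc⟩ :=
    exists_limit_of_not_conjecture hcon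
  obtain ⟨q, hq⟩ : ∃ q : EuclideanSpace ℝ (Fin (m + 1)), ‖q‖ = 1 :=
    ⟨EuclideanSpace.single 0 1, by simp⟩
  obtain ⟨Φ, hΦ⟩ := exists_linearIsometry_range_eq_orthogonal m hq
  classical
  let S := {k // W k ≠ 0}
  let z : S → EuclideanSpace ℝ (Fin (m + 1)) := fun s => Φ (X s)
  let w : S → ℝ := fun s => W s
  have hR : √(2 : ℝ) ≠ 0 := Real.sqrt_ne_zero'.2 zero_lt_two
  have hzq : ∀ s, inner ℝ q (z s) = 0 := fun s => (hΦ _).2 ⟨_, rfl⟩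
  have hz : ∀ s, z s ≠ q := by
    intro s hs
    have := hzq s
    rw [hs, real_inner_self_eq_norm_sq, hq] at this
    norm_num at this
  have hzi : Function.Injective z := fun s t hst =>
    Subtype.ext (hinj s.2 t.2 (Φ.injective hst))
  have hzpot : ∀ s, coulombPotential z w s + c = 0 := by
    intro s
    refine Eq.trans ?_ (hpot s s.2)
    rw [coulombPotential_comp Φ (fun s : S => X s)]
    congr 1
    refine Fintype.sum_of_injective _ Subtype.val_injective _ _ (fun k hk => ?_) fun _ => rfl
    rw [Subtype.range_coe_subtype, Set.mem_ofPred_eq, not_not] at hk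
    rw [hk, zero_div]
  have hzfield : ∀ s, coulombField z w s = 0 := by
    intro s
    rw [coulombField_comp Φ (fun s : S => X s)]
    refine (congrArg Φ (Eq.trans ?_ (hfield s s.2))).trans (map_zero Φ)
    refine Fintype.sum_of_injective _ Subtype.val_injective _ _ (fun k hk => ?_) fun _ => rfl
    rw [Subtype.range_coe_subtype, Set.mem_ofPred_eq, not_not] at hk
    rw [hk, zero_div, zero_smul]
  have hinv1 : ∀ s, ‖inversion q √2 (z s)‖ = 1 := fun s =>
    norm_inversion_of_inner_eq_zero hq (hzq s)
  have hnz : w ⟨i, hWi⟩ / ‖z ⟨i, hWi⟩ - q‖ ≠ 0 :=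
    div_ne_zero hWi (norm_ne_zero_iff.2 (sub_ne_zero.2 (hz _)))
  rcases eq_or_ne c 0 with rfl | hc0
  · have hcard : 2 ≤ Fintype.card S := by
      -- A single charge `W i` would create a non-zero potential at `X l`.
      by_contra! hlt
      have hsub : ∀ k, k ≠ i → W k = 0 := by
        intro k hk
        by_contra hWk
        exact hk (congrArg Subtype.val (Fintype.card_le_one_iff.1 (Nat.lt_succ_iff.1 hlt)
          ⟨k, hWk⟩ ⟨i, hWi⟩))
      rw [add_zero, coulombPotential, Finset.sum_eq_single i
        (fun k _ hk => by rw [hsub k hk, zero_div]) (by simp)] at hpotl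
      exact div_ne_zero hWi (norm_ne_zero_iff.2 (sub_ne_zero.2 hli)) hpotl
    have hle : Fintype.card S ≤ p₀ :=
      ((Fintype.card_subtype_le _).trans_eq (Fintype.card_fin p)).trans hp
    refine hnz (congrFun (H.eq_zero hcard hle ((inversion_injective q hR).comp hzi) hinv1
      (v := fun s => w s / ‖z s - q‖) fun s => ?_) ⟨i, hWi⟩)
    have := coulombField_inversion hR q z hz w s
    rw [hzfield, show coulombPotential z w s = 0 by simpa using hzpot s] at this
    exact this.trans (by simp)
  · -- As `W j = 0` for some `j`, there is room for one more point, the pole `q`.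
    obtain ⟨j, hj⟩ := hc hc0
    have hlt : Fintype.card S < p :=
      (Fintype.card_subtype_lt (x := j) (by simpa using hj)).trans_eq (Fintype.card_fin p)
    have hpos : 0 < Fintype.card S := Fintype.card_pos_iff.2 ⟨⟨i, hWi⟩⟩
    refine hnz (congrFun (H.eq_zero (ι := Option S) (by rw [Fintype.card_option]; omega)
      (by rw [Fintype.card_option]; omega) ?_ ?_
      (coulombField_option_inversion hz hzpot hzfield hc0)) (some ⟨i, hWi⟩))
    · have hne : ∀ s, inversion q √2 (z s) ≠ q := fun s h =>
        hz s ((inversion_eq_center hR).1 h)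
      rintro (_ | s) (_ | t) hst
      · rfl
      · exact absurd hst.symm (hne t)
      · exact absurd hst (hne s)
      · exact congrArg some (hzi (inversion_injective q hR hst))
    · rintro (_ | s)
      · exact hq
      · exact hinv1 s

end Hyperplane

end BahriXu

theorem mainTheorem2 (m p₀ : ℕ) (hp₀ : 4 ≤ p₀) :
    (∀ p : ℕ, 4 ≤ p → p ≤ p₀ → BahriXu.Conjecture p m) ↔
      ∀ p : ℕ, 4 ≤ p → p ≤ p₀ →
        ∀ y : Fin p → EuclideanSpace ℝ (Fin (m + 1)), Function.Injective y →
          (∀ i, y i ∈ Metric.sphere (0 : EuclideanSpace ℝ (Fin (m + 1))) 1) →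
            ∀ v : Fin p → ℝ,
              (∀ i, ∑ j ∈ Finset.univ.erase i, (v j / ‖y i - y j‖ ^ 3) • (y i - y j) = 0) →
                v = 0 := by
  simp only [mem_sphere_zero_iff_norm, ← BahriXu.coulombField_eq_sum_erase]
  constructor
  · intro h p hp hpp y hy hy1 v hv
    exact (h p hp hpp).eq_zero_of_sphere (by omega) hy hy1 hv
  · intro h p hp hpp
    exact (BahriXu.sphereRigid_of_four_le h).conjecture hpp
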